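/- An online minimization problem consists of sets of initial configurations, requests and answers, and of a cost $\mathrm{cost}(I,x,y)\in[0,\infty]$ for every initial configuration $I$, request sequence $x=(x_1,\dots,x_n)$ and answer sequence $y=(y_1,\dots,y_n)$ of the same length; $y$ is a valid solution of the input $(I,x)$ if this cost is finite. Let $\mathrm{Opt}(I,x)$ be the infimum of the costs of the valid solutions of $(I,x)$. The problem is *partitionable* if there is a function $p\ge 0$ with $\mathrm{cost}(I,x,y)=\sum_{i=1}^n p(I;x_1,\dots,x_i;y_1,\dots,y_i)$ for all $I,x,y$. Call two triples $(I,x,y)$, $(I',x',y')$, where $y$ is a valid solution of $(I,x)$ and $y'$ of $(I',x')$, equivalent if for all sequences $x'',y''$ the sequence $y\cdot y''$ is a valid solution of $(I,x\cdot x'')$ if and only if $y'\cdot y''$ is a valid solution of $(I',x'\cdot x'')$, and in this case the additional cost incurred by $y''$ is the same for both. A *state* is an equivalence class of such triples. A state is *initial* if it contains a triple $(I,\lambda,\lambda)$, where $\lambda$ is the empty sequence. For a state $s$ and a request sequence $x''$, let $\mathrm{Opt}_s(x'')$ be the infimum of the additional cost incurred by $y''$ over all valid continuations $y''$ of a triple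 in $s$ ($\infty$ if there is none). The problem is *symmetric* if it is partitionable and every state is initial. It is *opt-bounded* if there is a constant $B$ such that $\mathrm{Opt}_s(x)$ is finite and $|\mathrm{Opt}_s(x)-\mathrm{Opt}_{s'}(x)|\le B$ for all states $s,s'$ and all request sequences $x$. A randomized online algorithm computes each answer $y_i$ from $I,x_1,\dots,x_i$ and an infinite tape $\phi$ of independent fair random bits; for fixed $I,x_1,\dots,x_i$, the answer $y_i$ is a discrete random variable (countably many values, each taken on a measurable event). Let $\mathrm{cost}(R(I,x))$ be the random cost of the solution that the algorithm $R$ computes on $(I,x)$. The algorithm $R$ is *$r$-competitive in expectation* if there is a constant $\alpha$ such that $\mathbb{E}[\mathrm{cost}(R(I,x))]\le r\cdot\mathrm{Opt}(I,x)+\alpha$ for all inputs $(I,x)$ that have a valid solution. It is *$r$-competitive with high probability* if for every $\beta\ge 1$ there is a constant $\alpha$ such that, for all inputs $(I,x)$ that have a valid solution, $$\Pr\bigl[\mathrm{cost}(R(I,x))\ge r\cdot\mathrm{Opt}(I,x)+\alpha\bigr]\le\bigl(2+\mathrm{Opt}(I,x)\bigr)^{-\beta}.$$ **Theorem.** Consider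 an opt-bounded symmetric online minimization problem for which there is a randomized online algorithm that is $r$-competitive in expectation, where $r\ge 1$ is a constant. Then for every constant $\varepsilon>0$ there is a randomized online algorithm that is $(1+\varepsilon)r$-competitive with high probability. -/

import Mathlib

open MeasureTheory
open scoped ENNReal NNReal

/-- An online minimization problem with initial configurations in `Conf`, requests in `Req` and
answers in `Ans`. `cost I x y` is the cost of answering the request sequence `x` by the answer
sequence `y` when starting from `I`; the value `∞` says that `y` is not a feasible solution.
Only the values at sequences `x`, `y` of the same length matter. -/
structure OnlineProblem (Conf Req Ans : Type*) where
  cost : Conf → List Req → List Ans → ℝ≥0∞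

namespace OnlineProblem

variable {Conf Req Ans : Type*}

/-- `y` is a valid solution of the input `(I, x)`. -/
def Valid (P : OnlineProblem Conf Req Ans) (I : Conf) (x : List Req) (y : List Ans) : Prop :=
  x.length = y.length ∧ P.cost I x y ≠ ∞

/-- The optimal cost of the input `(I, x)` (`∞` if there is no valid solution). -/
noncomputable def opt (P : OnlineProblem Conf Req Ans) (I : Conf) (x : List Req) : ℝ≥0∞ :=
  ⨅ (y : List Ans) (_ : P.Valid I x y), P.cost I x y

/-- The cost of a solution is the sum of non-negative costs of its single answers, where the cost
of an answer depends only on the initial configuration and on the requests and answers so far. -/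
def Partitionable (P : OnlineProblem Conf Req Ans) : Prop :=
  ∃ p : Conf → List Req → List Ans → ℝ≥0∞,
    ∀ (I : Conf) (x : List Req) (y : List Ans), x.length = y.length →
      P.cost I x y = ∑ i ∈ Finset.range x.length, p I (x.take (i + 1)) (y.take (i + 1))

/-- A triple `(I, x, y)` where `y` is a valid solution of the input `(I, x)`. -/
structure History (P : OnlineProblem Conf Req Ans) where
  init : Conf
  requests : List Req
  answers : List Ans
  valid : P.Valid init requests answers

namespace History

variable {P : OnlineProblem Conf Req Ans}

/-- After the history `h`, the requests `x` may be answered by `y`. -/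
def ValidNext (h : P.History) (x : List Req) (y : List Ans) : Prop :=
  P.Valid h.init (h.requests ++ x) (h.answers ++ y)

/-- The cost of the answers `y` to the requests `x` that follow the history `h`. The cost of
`h` itself is finite, and for a partitionable problem it is at most the total cost. -/
noncomputable def nextCost (h : P.History) (x : List Req) (y : List Ans) : ℝ≥0∞ :=
  P.cost h.init (h.requests ++ x) (h.answers ++ y) - P.cost h.init h.requests h.answers

/-- Two histories are equivalent if they have the same valid continuations, at the same cost. -/
def Equivalent (h h' : P.History) : Prop :=
  ∀ (x : List Req) (y : List Ans),
    (h.ValidNext x y ↔ h'.ValidNext x y) ∧ (h.ValidNext x y → h.nextCost x y = h'.nextCost x y)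

/-- The optimal cost of serving the requests `x` after the history `h`. -/
noncomputable def opt (h : P.History) (x : List Req) : ℝ≥0∞ :=
  ⨅ (y : List Ans) (_ : h.ValidNext x y), h.nextCost x y

theorem Equivalent.opt_eq {h h' : P.History} (e : h.Equivalent h') : h.opt = h'.opt := by
  funext x
  refine iInf_congr fun y => ?_
  by_cases hv : h.ValidNext x y
  · have hv' := (e x y).1.mp hv
    simp [hv, hv', (e x y).2 hv]
  · have hv' : ¬ h'.ValidNext x y := fun k => hv ((e x y).1.mpr k)
    simp [hv, hv']

instance setoid (P : OnlineProblem Conf Req Ans) : Setoid P.History where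
  r := Equivalent
  iseqv :=
    { refl := fun _ _ _ => ⟨Iff.rfl, fun _ => rfl⟩
      symm := fun e x y => ⟨(e x y).1.symm, fun v => ((e x y).2 ((e x y).1.mpr v)).symm⟩
      trans := fun e e' x y => ⟨(e x y).1.trans (e' x y).1,
        fun v => ((e x y).2 v).trans ((e' x y).2 ((e x y).1.mp v))⟩ }

end History

/-- A state of the problem is an equivalence class of histories. -/
def State (P : OnlineProblem Conf Req Ans) : Type _ := Quotient (History.setoid P)

namespace State

variable {P : OnlineProblem Conf Req Ans}

/-- The optimal cost of serving the requests `x` starting from the state `s`. -/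
noncomputable def opt (s : P.State) : List Req → ℝ≥0∞ :=
  Quotient.lift History.opt (fun _ _ e => History.Equivalent.opt_eq e) s

/-- A state is initial if it contains some triple `(I, [], [])`. -/
def IsInitial (s : P.State) : Prop :=
  ∃ h : P.History, h.requests = [] ∧ h.answers = [] ∧ Quotient.mk (History.setoid P) h = s

end State

/-- The optimal costs of serving the same requests from two states are finite and differ by at
most a constant `B`. -/
def OptBounded (P : OnlineProblem Conf Req Ans) : Prop :=
  ∃ B : ℝ≥0, ∀ (s s' : P.State) (x : List Req), s.opt x ≠ ∞ ∧ s.opt x ≤ s'.opt x + B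

/-- Partitionable, and every state is initial. -/
def Symmetric (P : OnlineProblem Conf Req Ans) : Prop :=
  P.Partitionable ∧ ∀ s : P.State, s.IsInitial

end OnlineProblem

/-- The contents of a random tape. -/
abbrev Tape : Type := ℕ → Bool

/-- The law of the random tape: independent fair bits. -/
noncomputable def tapeMeasure : Measure Tape :=
  Measure.infinitePi fun _ : ℕ => (PMF.uniformOfFintype Bool).toMeasure

/-- A randomized online algorithm. The answer to the last request of the non-empty sequence `x` is
`answer φ I x`, where `φ` is the content of the random tape; the value at `x = []` is irrelevant.
Every answer is a discrete random variable: it takes countably many values, each on a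
measurable event. -/
structure RandomizedOnlineAlgorithm (Conf Req Ans : Type*) where
  answer : Tape → Conf → List Req → Ans
  countable_range : ∀ (I : Conf) (x : List Req), (Set.range fun φ => answer φ I x).Countable
  measurableSet_fiber : ∀ (I : Conf) (x : List Req) (a : Ans),
    MeasurableSet {φ | answer φ I x = a}

namespace RandomizedOnlineAlgorithm

variable {Conf Req Ans : Type*}

/-- The output sequence `(y₁, …, yₙ)`, where `yᵢ` is computed from `φ`, `I` and `x₁, …, xᵢ`. -/
def output (A : RandomizedOnlineAlgorithm Conf Req Ans) (φ : Tape) (I : Conf) (x : List Req) :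
    List Ans :=
  (List.range x.length).map fun i => A.answer φ I (x.take (i + 1))

/-- The cost of the solution computed by `A`, as a random variable on the tapes. -/
noncomputable def cost (A : RandomizedOnlineAlgorithm Conf Req Ans)
    (P : OnlineProblem Conf Req Ans) (I : Conf) (x : List Req) (φ : Tape) : ℝ≥0∞ :=
  P.cost I x (A.output φ I x)

/-- `A` is `r`-competitive in expectation for `P`. -/
def CompetitiveInExpectation (A : RandomizedOnlineAlgorithm Conf Req Ans)
    (P : OnlineProblem Conf Req Ans) (r : ℝ) : Prop :=
  ∃ α : ℝ≥0, ∀ (I : Conf) (x : List Req), P.opt I x ≠ ∞ →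
    ∫⁻ φ, A.cost P I x φ ∂tapeMeasure ≤ ENNReal.ofReal r * P.opt I x + α

/-- `A` is `r`-competitive with high probability for `P`. -/
def CompetitiveWHP (A : RandomizedOnlineAlgorithm Conf Req Ans)
    (P : OnlineProblem Conf Req Ans) (r : ℝ) : Prop :=
  ∀ β : ℝ, 1 ≤ β → ∃ α : ℝ≥0, ∀ (I : Conf) (x : List Req), P.opt I x ≠ ∞ →
    tapeMeasure {φ | ENNReal.ofReal r * P.opt I x + α ≤ A.cost P I x φ} ≤
      (2 + P.opt I x) ^ (-β)

end RandomizedOnlineAlgorithm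

/-! The new algorithm simulates `A` in independent runs. A run ends when its requests have optimal
cost at least `C` from the best state, or when its cost exceeds `D`. The request that ends it gets a
nearly greedy answer; by symmetry the state reached is equivalent to an initial one, where `A`
starts afresh on new random bits.

Three facts make this work. First, `minOpt`, the optimum over all states, is superadditive
(`Partitionable.minOpt_add_le`), so consecutive runs can be charged to the optimum of the whole
input, and opt-boundedness keeps it within `B` of the true optimum. Second, a run whose requests
reach optimal cost `C` has slack `ε * r * C`, which absorbs the additive terms `r * B + α` and the
greedy answer. Cost cutoffs are rare by Markov's inequality, and truncation bounds the loss of a run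
by `M`. Thus the loss has mean at most `-1`, and its exponential moment with parameter `M⁻¹ ^ 2` is
at most `1` (`lintegral_exp_runLoss_le_one`). Third, since the next run uses fresh bits, these
moments multiply: induction on the input bounds the exponential moment of the total cost
(`expMoment_le`), playing the role of a supermartingale bound.

Markov's inequality for the exponential then gives a tail exponentially small in the optimum, which
beats every power once the additive constant depends on `β`. -/

/-! ### Discrete random variables -/

/-- A map with countable range and measurable fibers. -/
def DiscreteMap {Ω β : Type*} [MeasurableSpace Ω] (f : Ω → β) : Prop :=
  (Set.range f).Countable ∧ ∀ b, MeasurableSet {ω | f ω = b}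

namespace DiscreteMap

variable {Ω Ω' β γ δ : Type*} [MeasurableSpace Ω] [MeasurableSpace Ω']

theorem const (b : β) : DiscreteMap fun _ : Ω => b :=
  ⟨(Set.countable_singleton b).mono (by rintro _ ⟨_, rfl⟩; rfl), fun _ => .const _⟩

theorem comp_measurable {f : Ω → β} (hf : DiscreteMap f) {g : Ω' → Ω} (hg : Measurable g) :
    DiscreteMap fun ω => f (g ω) :=
  ⟨hf.1.mono (by rintro _ ⟨ω, rfl⟩; exact ⟨g ω, rfl⟩), fun b => hg (hf.2 b)⟩

/-- Conditioning on the countably many values of `f` reduces each fiber to a countable union. This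
permits arbitrary restart rules, with no measurable structure on the answers. -/
theorem bind {f : Ω → β} (hf : DiscreteMap f) {F : β → Ω → γ} (hF : ∀ b, DiscreteMap (F b)) :
    DiscreteMap fun ω => F (f ω) ω := by
  refine ⟨(hf.1.biUnion fun b _ => (hF b).1).mono ?_, fun c => ?_⟩
  · rintro _ ⟨ω, rfl⟩
    exact Set.mem_biUnion ⟨ω, rfl⟩ ⟨ω, rfl⟩
  · have : {ω | F (f ω) ω = c} = ⋃ b ∈ Set.range f, {ω | f ω = b} ∩ {ω | F b ω = c} := by
      ext ω
      simp only [Set.mem_ofPred_eq, Set.mem_iUnion, Set.mem_inter_iff, exists_prop]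
      exact ⟨fun h => ⟨_, ⟨ω, rfl⟩, rfl, h⟩, fun ⟨_, _, h, h'⟩ => h ▸ h'⟩
    rw [this]
    exact .biUnion hf.1 fun b _ => (hf.2 b).inter ((hF b).2 c)

theorem map {f : Ω → β} (hf : DiscreteMap f) (g : β → γ) : DiscreteMap fun ω => g (f ω) :=
  hf.bind (F := fun b _ => g b) fun b => const (g b)

theorem map₂ {f : Ω → β} {g : Ω → γ} (hf : DiscreteMap f) (hg : DiscreteMap g)
    (k : β → γ → δ) : DiscreteMap fun ω => k (f ω) (g ω) :=
  hf.bind (F := fun b ω => k b (g ω)) fun b => hg.map (k b)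

theorem list_map {ι : Type*} {f : ι → Ω → β} (hf : ∀ i, DiscreteMap (f i)) (l : List ι) :
    DiscreteMap fun ω => l.map fun i => f i ω := by
  induction l with
  | nil => exact const []
  | cons i l ih => exact (hf i).map₂ ih List.cons

theorem measurable [MeasurableSpace γ] {f : Ω → β} (hf : DiscreteMap f) (g : β → γ) :
    Measurable fun ω => g (f ω) := by
  intro s _
  have : (fun ω => g (f ω)) ⁻¹' s = ⋃ b ∈ Set.range f ∩ g ⁻¹' s, {ω | f ω = b} := by
    ext ω
    simp
  rw [this]
  exact .biUnion (hf.1.mono Set.inter_subset_left) fun b _ => hf.2 b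

end DiscreteMap

/-! ### Splitting one random tape into two independent ones -/

namespace Tape

/-- The bits at the even positions of a tape. -/
def evens (φ : Tape) : Tape := fun n => φ (2 * n)

/-- The bits at the odd positions of a tape. -/
def odds (φ : Tape) : Tape := fun n => φ (2 * n + 1)

/-- The tape with given bits at the even and at the odd positions. -/
def interleave (p : Tape × Tape) : Tape := fun n => if n % 2 = 0 then p.1 (n / 2) else p.2 (n / 2)

theorem measurable_evens : Measurable evens :=
  measurable_pi_lambda _ fun n => measurable_pi_apply (2 * n)

theorem measurable_odds : Measurable odds :=
  measurable_pi_lambda _ fun n => measurable_pi_apply (2 * n + 1)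

theorem measurable_interleave : Measurable interleave := by
  refine measurable_pi_lambda _ fun n => ?_
  by_cases h : n % 2 = 0
  · simp only [interleave, h, if_true]
    exact (measurable_pi_apply (X := fun _ : ℕ => Bool) (n / 2)).comp measurable_fst
  · simp only [interleave, h, if_false]
    exact (measurable_pi_apply (X := fun _ : ℕ => Bool) (n / 2)).comp measurable_snd

theorem evens_interleave (p : Tape × Tape) : evens (interleave p) = p.1 := by
  funext n
  simp [evens, interleave]

theorem odds_interleave (p : Tape × Tape) : odds (interleave p) = p.2 := by
  funext n
  have h : (2 * n + 1) % 2 = 1 := by omega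
  have h' : (2 * n + 1) / 2 = n := by omega
  simp [odds, interleave, h']

end Tape

instance : IsProbabilityMeasure tapeMeasure := by
  unfold tapeMeasure
  infer_instance

/-- A product measure is determined by finite boxes; the preimage of a box splits into a box for the
even positions and one for the odd positions. -/
theorem map_interleave_tapeMeasure :
    (tapeMeasure.prod tapeMeasure).map Tape.interleave = tapeMeasure := by
  unfold tapeMeasure
  refine Measure.eq_infinitePi _ fun s t ht => ?_
  have hs : MeasurableSet (Set.pi (s : Set ℕ) t) :=
    .pi s.countable_toSet fun i _ => ht i
  rw [Measure.map_apply Tape.measurable_interleave hs]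
  let S₀ := (s.filter fun n => n % 2 = 0).image (· / 2)
  let S₁ := (s.filter fun n => ¬ n % 2 = 0).image (· / 2)
  have key : Tape.interleave ⁻¹' Set.pi (s : Set ℕ) t =
      Set.pi (S₀ : Set ℕ) (fun n => t (2 * n)) ×ˢ Set.pi (S₁ : Set ℕ) (fun n => t (2 * n + 1)) := by
    ext ⟨ψ, θ⟩
    simp only [Set.mem_preimage, Set.mem_pi, Set.mem_prod, Finset.mem_coe, S₀, S₁,
      Finset.mem_image, Finset.mem_filter, Tape.interleave]
    constructor
    · refine fun h => ⟨?_, ?_⟩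
      · rintro _ ⟨n, ⟨hn, hn'⟩, rfl⟩
        have := h n hn
        rw [if_pos hn'] at this
        rwa [show 2 * (n / 2) = n by omega]
      · rintro _ ⟨n, ⟨hn, hn'⟩, rfl⟩
        have := h n hn
        rw [if_neg hn'] at this
        rwa [show 2 * (n / 2) + 1 = n by omega]
    · rintro ⟨h₀, h₁⟩ n hn
      split_ifs with hn'
      · have := h₀ _ ⟨n, ⟨hn, hn'⟩, rfl⟩
        rwa [show 2 * (n / 2) = n by omega] at this
      · have := h₁ _ ⟨n, ⟨hn, hn'⟩, rfl⟩
        rwa [show 2 * (n / 2) + 1 = n by omega] at this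
  rw [key, Measure.prod_prod, Measure.infinitePi_pi _ fun i _ => ht _,
    Measure.infinitePi_pi _ fun i _ => ht _,
    ← Finset.prod_filter_mul_prod_filter_not s (fun n => n % 2 = 0)]
  congr 1
  · rw [Finset.prod_image]
    · refine Finset.prod_congr rfl fun n hn => ?_
      rw [show 2 * (n / 2) = n by have := (Finset.mem_filter.mp hn).2; omega]
    · intro a ha b hb hab
      have := (Finset.mem_filter.mp ha).2
      have := (Finset.mem_filter.mp hb).2
      simp only at hab
      omega
  · rw [Finset.prod_image]
    · refine Finset.prod_congr rfl fun n hn => ?_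
      rw [show 2 * (n / 2) + 1 = n by have := (Finset.mem_filter.mp hn).2; omega]
    · intro a ha b hb hab
      have := (Finset.mem_filter.mp ha).2
      have := (Finset.mem_filter.mp hb).2
      simp only at hab
      omega

theorem lintegral_evens_odds {f : Tape × Tape → ℝ≥0∞} (hf : Measurable f) :
    ∫⁻ φ, f (φ.evens, φ.odds) ∂tapeMeasure = ∫⁻ p, f p ∂(tapeMeasure.prod tapeMeasure) := by
  conv_lhs => rw [← map_interleave_tapeMeasure]
  rw [lintegral_map (f := fun φ => f (φ.evens, φ.odds))
    (hf.comp (Tape.measurable_evens.prodMk Tape.measurable_odds)) Tape.measurable_interleave]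
  simp only [Tape.evens_interleave, Tape.odds_interleave]

/-! ### Exponential moment of a single run -/

/-- For `|v| ≤ 1` one has `exp v ≤ 1 + v + v ^ 2`. With `v = l * u` and `l = M⁻¹ ^ 2` the quadratic
term is at most `l`, which the mean `-1` of `u` compensates. -/
theorem lintegral_exp_le_one {Ω : Type*} [MeasurableSpace Ω] {μ : Measure Ω}
    [IsProbabilityMeasure μ] {u : Ω → ℝ} (hu : Measurable u) {M : ℝ} (hM : 1 ≤ M)
    (hb : ∀ ω, |u ω| ≤ M) (hmean : ∫ ω, u ω ∂μ ≤ -1) :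
    ∫⁻ ω, ENNReal.ofReal (Real.exp (M⁻¹ ^ 2 * u ω)) ∂μ ≤ 1 := by
  have hM0 : 0 < M := by linarith
  set l := M⁻¹ ^ 2 with hl
  have hl0 : 0 < l := by positivity
  have hlM : l * M ^ 2 = 1 := by rw [hl, inv_pow]; exact inv_mul_cancel₀ (by positivity)
  have hint : Integrable u μ := .of_bound hu.aestronglyMeasurable M (ae_of_all _ hb)
  have hexp (ω : Ω) : Real.exp (l * u ω) ≤ 1 + l + l * u ω := by
    have h₁ : |l * u ω| ≤ 1 := by
      rw [abs_mul, abs_of_pos hl0]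
      nlinarith [hb ω, mul_le_mul_of_nonneg_left (hb ω) hl0.le]
    have h₂ := (abs_le.mp (Real.abs_exp_sub_one_sub_id_le h₁)).2
    have h₃ : u ω ^ 2 ≤ M ^ 2 := sq_le_sq' (abs_le.mp (hb ω)).1 (abs_le.mp (hb ω)).2
    have h₄ : (l * u ω) ^ 2 ≤ l := by
      calc (l * u ω) ^ 2 = l * (l * u ω ^ 2) := by ring
        _ ≤ l * (l * M ^ 2) := by gcongr
        _ = l := by rw [hlM, mul_one]
    linarith
  have hint' : Integrable (fun ω => 1 + l + l * u ω) μ :=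
    (integrable_const _).add (hint.const_mul l)
  calc _ ≤ ∫⁻ ω, ENNReal.ofReal (1 + l + l * u ω) ∂μ :=
        lintegral_mono fun ω => ENNReal.ofReal_le_ofReal (hexp ω)
    _ = ENNReal.ofReal (∫ ω, 1 + l + l * u ω ∂μ) :=
        (ofReal_integral_eq_lintegral_ofReal hint'
          (ae_of_all _ fun ω => (Real.exp_pos _).le.trans (hexp ω))).symm
    _ ≤ ENNReal.ofReal 1 := by
        refine ENNReal.ofReal_le_ofReal ?_
        rw [integral_add (integrable_const _) (hint.const_mul l), integral_const_mul]
        simp only [integral_const, probReal_univ, smul_eq_mul, one_mul]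
        nlinarith
    _ = 1 := ENNReal.ofReal_one

/-- The loss of a run of cost `X`, cut off at `D`, that gains `a` if it is not cut off and loses
another `b` otherwise. -/
noncomputable def runLoss (D a b : ℝ) (X : ℝ≥0∞) : ℝ :=
  if X ≤ ENNReal.ofReal D then X.toReal - a else D + b

/-- Markov's inequality in pointwise form: beyond `D`, the term `X * (a + b) / D` already pays for
`a + b`. Its mean is at most `1` by `hQ`, and the margin `2` in `hEa` leaves mean loss at most `-1`.
-/
theorem lintegral_exp_runLoss_le_one {Ω : Type*} [MeasurableSpace Ω] {μ : Measure Ω}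
    [IsProbabilityMeasure μ] {X : Ω → ℝ≥0∞} (hX : Measurable X) {D E a b M : ℝ}
    (hD : 0 < D) (hE : 0 ≤ E) (hb : 0 ≤ b) (hM : 1 ≤ M) (haM : a + b + D ≤ M)
    (hXE : ∫⁻ ω, X ω ∂μ ≤ ENNReal.ofReal E) (hQ : (a + b) * E ≤ D) (hEa : E + 2 ≤ a) :
    ∫⁻ ω, ENNReal.ofReal (Real.exp (M⁻¹ ^ 2 * runLoss D a b (X ω))) ∂μ ≤ 1 := by
  have hS : MeasurableSet {ω | X ω ≤ ENNReal.ofReal D} := hX measurableSet_Iic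
  have hXtop : ∀ᵐ ω ∂μ, X ω < ∞ :=
    ae_lt_top hX (ne_top_of_le_ne_top ENNReal.ofReal_ne_top hXE)
  have hXint : Integrable (fun ω => (X ω).toReal) μ :=
    integrable_toReal_of_lintegral_ne_top hX.aemeasurable
      (ne_top_of_le_ne_top ENNReal.ofReal_ne_top hXE)
  have hXmean : ∫ ω, (X ω).toReal ∂μ ≤ E := by
    rw [integral_toReal hX.aemeasurable hXtop]
    exact ENNReal.toReal_le_of_le_ofReal hE hXE
  have ha0 : 0 ≤ a := by linarith
  have hmeas : Measurable fun ω => runLoss D a b (X ω) :=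
    .ite hS (hX.ennreal_toReal.sub_const a) measurable_const
  have habs (ω : Ω) : |runLoss D a b (X ω)| ≤ M := by
    unfold runLoss
    split_ifs with h
    · have h₁ := ENNReal.toReal_le_of_le_ofReal hD.le h
      have h₂ : 0 ≤ (X ω).toReal := ENNReal.toReal_nonneg
      rw [abs_le]
      constructor <;> linarith
    · rw [abs_le]
      constructor <;> linarith
  refine lintegral_exp_le_one hmeas hM habs ?_
  have hbound : ∀ᵐ ω ∂μ, runLoss D a b (X ω) ≤ (X ω).toReal * (1 + (a + b) / D) - a := by
    filter_upwards [hXtop] with ω hω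
    have h₂ : 0 ≤ (X ω).toReal := ENNReal.toReal_nonneg
    have h₃ : 0 ≤ (a + b) / D := by positivity
    unfold runLoss
    split_ifs with h
    · nlinarith [mul_nonneg h₂ h₃]
    · have h₁ : D ≤ (X ω).toReal := by
        rw [← ENNReal.ofReal_le_iff_le_toReal hω.ne]
        exact (not_le.mp h).le
      have h₄ : D * ((a + b) / D) = a + b := mul_div_cancel₀ _ hD.ne'
      nlinarith [mul_le_mul_of_nonneg_right h₁ h₃]
  calc _ ≤ ∫ ω, ((X ω).toReal * (1 + (a + b) / D) - a) ∂μ := by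
        exact integral_mono_ae (.of_bound hmeas.aestronglyMeasurable M (ae_of_all _ habs))
          ((hXint.mul_const _).sub (integrable_const a)) hbound
    _ = (∫ ω, (X ω).toReal ∂μ) * (1 + (a + b) / D) - a := by
        rw [integral_sub (hXint.mul_const _) (integrable_const _), integral_mul_const]
        simp
    _ ≤ E * (1 + (a + b) / D) - a := by
        have : 0 ≤ 1 + (a + b) / D := by positivity
        gcongr
    _ ≤ -1 := by
        have : E * ((a + b) / D) ≤ 1 := by
          rw [← mul_div_assoc, div_le_one hD]
          linarith
        linarith

/-! ### Continuations of histories and superadditivity of the optimum -/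

namespace OnlineProblem

variable {Conf Req Ans : Type*} {P : OnlineProblem Conf Req Ans}

theorem Partitionable.cost_nil (hP : P.Partitionable) (I : Conf) : P.cost I [] [] = 0 := by
  obtain ⟨p, hp⟩ := hP
  simp [hp I [] [] rfl]

theorem Partitionable.cost_le_append (hP : P.Partitionable) (I : Conf) {x : List Req}
    {y : List Ans} (h : x.length = y.length) {x' : List Req} {y' : List Ans}
    (h' : x'.length = y'.length) : P.cost I x y ≤ P.cost I (x ++ x') (y ++ y') := by
  obtain ⟨p, hp⟩ := hP
  rw [hp I x y h, hp I (x ++ x') (y ++ y') (by simp [h, h'])]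
  calc _ = ∑ i ∈ Finset.range x.length,
        p I ((x ++ x').take (i + 1)) ((y ++ y').take (i + 1)) := by
        refine Finset.sum_congr rfl fun i hi => ?_
        have hi := Finset.mem_range.mp hi
        rw [List.take_append_of_le_length (by omega), List.take_append_of_le_length (by omega)]
    _ ≤ _ := Finset.sum_le_sum_of_subset (Finset.range_mono (by simp))

theorem Partitionable.valid_nil (hP : P.Partitionable) (I : Conf) : P.Valid I [] [] :=
  ⟨rfl, by simp [hP.cost_nil]⟩

theorem Partitionable.valid_of_append (hP : P.Partitionable) {I : Conf} {x x' : List Req}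
    {y y' : List Ans} (h : x.length = y.length) (hv : P.Valid I (x ++ x') (y ++ y')) :
    P.Valid I x y := by
  have hl := hv.1
  simp only [List.length_append] at hl
  exact ⟨h, ne_top_of_le_ne_top hv.2 (hP.cost_le_append I h (by omega))⟩

/-- The history in which nothing has happened yet. -/
def Partitionable.start (hP : P.Partitionable) (I : Conf) : P.History :=
  ⟨I, [], [], hP.valid_nil I⟩

namespace History

/-- The history `h` continued by answering `x` by `y`. -/
def extend (h : P.History) {x : List Req} {y : List Ans} (hv : h.ValidNext x y) : P.History :=
  ⟨h.init, h.requests ++ x, h.answers ++ y, hv⟩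

theorem ValidNext.length_eq {h : P.History} {x : List Req} {y : List Ans}
    (hv : h.ValidNext x y) : x.length = y.length := by
  have h₁ := hv.1
  have h₂ := h.valid.1
  simp only [List.length_append] at h₁
  omega

theorem cost_add_nextCost (hP : P.Partitionable) {h : P.History} {x : List Req} {y : List Ans}
    (hv : h.ValidNext x y) :
    P.cost h.init h.requests h.answers + h.nextCost x y =
      P.cost h.init (h.requests ++ x) (h.answers ++ y) :=
  add_tsub_cancel_of_le (hP.cost_le_append _ h.valid.1 hv.length_eq)

theorem validNext_extend {h : P.History} {x x' : List Req} {y y' : List Ans}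
    (hv : h.ValidNext x y) :
    (h.extend hv).ValidNext x' y' ↔ h.ValidNext (x ++ x') (y ++ y') := by
  simp [ValidNext, extend]

theorem nextCost_append (hP : P.Partitionable) {h : P.History} {x x' : List Req}
    {y y' : List Ans} (hv : h.ValidNext x y) (hv' : (h.extend hv).ValidNext x' y') :
    h.nextCost (x ++ x') (y ++ y') = h.nextCost x y + (h.extend hv).nextCost x' y' := by
  have h₁ := cost_add_nextCost hP hv
  have h₂ := cost_add_nextCost hP hv'
  have h₃ := cost_add_nextCost hP ((validNext_extend hv).mp hv')
  simp only [extend, List.append_assoc] at h₂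
  refine (ENNReal.add_right_inj h.valid.2).mp ?_
  rw [h₃, ← h₂, ← h₁, add_assoc]
  rfl

theorem opt_le {h : P.History} {x : List Req} {y : List Ans} (hv : h.ValidNext x y) :
    h.opt x ≤ h.nextCost x y :=
  iInf₂_le y hv

theorem exists_validNext_nextCost_le {h : P.History} {x : List Req} (hx : h.opt x ≠ ∞) :
    ∃ y, h.ValidNext x y ∧ h.nextCost x y ≤ h.opt x + 1 := by
  have : h.opt x < h.opt x + 1 := ENNReal.lt_add_right hx one_ne_zero
  obtain ⟨y, hy⟩ := iInf_lt_iff.mp this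
  obtain ⟨hv, hy⟩ := iInf_lt_iff.mp hy
  exact ⟨y, hv, hy.le⟩

end History

theorem Partitionable.validNext_start (hP : P.Partitionable) {I : Conf} {x : List Req}
    {y : List Ans} : (hP.start I).ValidNext x y ↔ P.Valid I x y := by
  simp [History.ValidNext, start]

theorem Partitionable.nextCost_start (hP : P.Partitionable) (I : Conf) (x : List Req)
    (y : List Ans) : (hP.start I).nextCost x y = P.cost I x y := by
  simp [History.nextCost, start, hP.cost_nil]

theorem Partitionable.opt_start (hP : P.Partitionable) (I : Conf) (x : List Req) :
    (hP.start I).opt x = P.opt I x := by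
  simp only [History.opt, OnlineProblem.opt, hP.validNext_start, hP.nextCost_start]

/-- In a symmetric problem, every history is equivalent to the start from some configuration. -/
theorem Symmetric.exists_start_equivalent (hP : P.Symmetric) (h : P.History) :
    ∃ I, h.Equivalent (hP.1.start I) := by
  obtain ⟨⟨I, x, y, hv⟩, hx, hy, e⟩ := hP.2 (Quotient.mk (History.setoid P) h)
  dsimp only at hx hy
  subst hx hy
  exact ⟨I, Quotient.exact e.symm⟩

/-- The optimal cost of the requests `x` from the best state. -/
noncomputable def minOpt (P : OnlineProblem Conf Req Ans) (x : List Req) : ℝ≥0∞ :=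
  ⨅ h : P.History, h.opt x

theorem minOpt_le (h : P.History) (x : List Req) : P.minOpt x ≤ h.opt x := iInf_le _ h

theorem Partitionable.minOpt_nil (hP : P.Partitionable) (I : Conf) : P.minOpt [] = 0 := by
  refine le_antisymm ((minOpt_le (hP.start I) []).trans ?_) zero_le
  refine (History.opt_le (y := []) (hP.validNext_start.mpr (hP.valid_nil I))).trans ?_
  rw [hP.nextCost_start, hP.cost_nil]

/-- Cut a solution after `u`: its second part continues a history whose state is among those over
which `minOpt v` is taken. -/
theorem Partitionable.minOpt_add_le (hP : P.Partitionable) (u v : List Req) :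
    P.minOpt u + P.minOpt v ≤ P.minOpt (u ++ v) := by
  refine le_iInf fun h => le_iInf₂ fun y hy => ?_
  have hl := hy.length_eq
  simp only [List.length_append] at hl
  obtain ⟨y₁, y₂, rfl, h₁⟩ : ∃ y₁ y₂, y = y₁ ++ y₂ ∧ u.length = y₁.length :=
    ⟨y.take u.length, y.drop u.length, (List.take_append_drop _ _).symm, by simp; omega⟩
  have hv : h.ValidNext u y₁ := by
    unfold History.ValidNext at hy
    rw [← List.append_assoc, ← List.append_assoc] at hy
    exact hP.valid_of_append (by simp [h.valid.1, h₁]) hy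
  have hv' := (History.validNext_extend hv).mpr hy
  rw [History.nextCost_append hP hv hv']
  exact add_le_add ((minOpt_le h u).trans (History.opt_le hv))
    ((minOpt_le _ v).trans (History.opt_le hv'))

/-- The problem is opt-bounded with the constant `B`. -/
theorem OptBounded.exists_bound (hP : P.OptBounded) :
    ∃ B : ℝ≥0, ∀ (h : P.History) (x : List Req), h.opt x ≠ ∞ ∧ h.opt x ≤ P.minOpt x + B := by
  obtain ⟨B, hB⟩ := hP
  refine ⟨B, fun h x => ⟨(hB (Quotient.mk _ h) (Quotient.mk _ h) x).1, ?_⟩⟩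
  rw [minOpt, ENNReal.iInf_add]
  exact le_iInf fun h' => (hB (Quotient.mk _ h) (Quotient.mk _ h') x).2

end OnlineProblem

/-! ### Restarting an online algorithm -/

namespace RandomizedOnlineAlgorithm

variable {Conf Req Ans : Type*} (A : RandomizedOnlineAlgorithm Conf Req Ans)

theorem length_output (φ : Tape) (I : Conf) (x : List Req) : (A.output φ I x).length = x.length := by
  simp [output]

theorem output_nil (φ : Tape) (I : Conf) : A.output φ I [] = [] := rfl

theorem output_concat (φ : Tape) (I : Conf) (x : List Req) (a : Req) :
    A.output φ I (x ++ [a]) = A.output φ I x ++ [A.answer φ I (x ++ [a])] := by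
  simp only [output, List.length_append, List.length_singleton, List.range_succ, List.map_append,
    List.map_cons, List.map_nil]
  congr 1
  · refine List.map_congr_left fun i hi => ?_
    rw [List.take_append_of_le_length (by simpa using hi)]
  · rw [List.take_of_length_le (by simp)]

theorem output_append (φ : Tape) (I : Conf) (x x' : List Req) :
    ∃ y', A.output φ I (x ++ x') = A.output φ I x ++ y' ∧ x'.length = y'.length := by
  induction x' using List.reverseRecOn with
  | nil => exact ⟨[], by simp, rfl⟩
  | append_singleton x' a ih =>
    obtain ⟨y', h, h'⟩ := ih
    refine ⟨y' ++ [A.answer φ I ((x ++ x') ++ [a])], ?_, by simp [h']⟩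
    rw [← List.append_assoc, output_concat, h, List.append_assoc]

theorem discreteMap_answer (I : Conf) (x : List Req) :
    DiscreteMap fun φ => A.answer φ I x :=
  ⟨A.countable_range I x, A.measurableSet_fiber I x⟩

theorem discreteMap_output (I : Conf) (x : List Req) :
    DiscreteMap fun φ => A.output φ I x :=
  .list_map (fun i => A.discreteMap_answer I (x.take (i + 1))) _

theorem measurable_cost (P : OnlineProblem Conf Req Ans) (I : Conf) (x : List Req) :
    Measurable (A.cost P I x) :=
  (A.discreteMap_output I x).measurable (P.cost I x)

/-- How to interrupt a run of an algorithm: after the history `(I, x, y)`, the run goes on if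
`go I x y` holds; otherwise the last answer is replaced by the answer `fallback I x y a` to the
last request `a`, where `x`, `y` come before it, and a fresh run starts from the configuration
`restart I x y` for the resulting history `(I, x, y)`. -/
structure RestartRule (Conf Req Ans : Type*) where
  go : Conf → List Req → List Ans → Prop
  fallback : Conf → List Req → List Ans → Req → Ans
  restart : Conf → List Req → List Ans → Conf

variable (R : RestartRule Conf Req Ans)

open Classical in
/-- The answers to `z` that follow a run of `A` on `(I, w)` with the tape `ψ`, where runs are
interrupted according to `R`. The fresh runs take their tapes from `θ`. -/
noncomputable def serve : Tape → Tape → Conf → List Req → List Req → List Ans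
  | _, _, _, _, [] => []
  | ψ, θ, I, w, a :: z =>
    if R.go I (w ++ [a]) (A.output ψ I (w ++ [a])) then
      A.answer ψ I (w ++ [a]) :: serve ψ θ I (w ++ [a]) z
    else
      R.fallback I w (A.output ψ I w) a :: serve θ.evens θ.odds
        (R.restart I (w ++ [a]) (A.output ψ I w ++ [R.fallback I w (A.output ψ I w) a])) [] z

theorem serve_nil (ψ θ : Tape) (I : Conf) (w : List Req) : A.serve R ψ θ I w [] = [] := by
  rw [serve]

/-- Later requests do not change earlier answers, so `serve` is the output of an online algorithm
whose answer is its last entry. -/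
theorem serve_concat (z : List Req) (a : Req) (ψ θ : Tape) (I : Conf) (w : List Req) :
    ∃ b, A.serve R ψ θ I w (z ++ [a]) = A.serve R ψ θ I w z ++ [b] := by
  induction z generalizing ψ θ I w with
  | nil =>
    simp only [List.nil_append, serve]
    split_ifs <;> exact ⟨_, rfl⟩
  | cons c z ih =>
    simp only [List.cons_append, serve]
    split_ifs
    · obtain ⟨b, hb⟩ := ih ψ θ I (w ++ [c])
      exact ⟨b, by rw [hb, List.cons_append]⟩
    · obtain ⟨b, hb⟩ := ih θ.evens θ.odds (R.restart I (w ++ [c])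
        (A.output ψ I w ++ [R.fallback I w (A.output ψ I w) c])) []
      exact ⟨b, by rw [hb, List.cons_append]⟩

theorem discreteMap_serve (z : List Req) (I : Conf) (w : List Req) :
    DiscreteMap fun p : Tape × Tape => A.serve R p.1 p.2 I w z := by
  induction z generalizing I w with
  | nil => simpa only [serve] using DiscreteMap.const []
  | cons a z ih =>
    have h₁ (x : List Req) : DiscreteMap fun p : Tape × Tape => A.output p.1 I x :=
      (A.discreteMap_output I x).comp_measurable measurable_fst
    have h₂ : DiscreteMap fun p : Tape × Tape => A.answer p.1 I (w ++ [a]) :=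
      (A.discreteMap_answer I (w ++ [a])).comp_measurable measurable_fst
    have h₃ (J : Conf) : DiscreteMap fun p : Tape × Tape =>
        A.serve R p.2.evens p.2.odds J [] z :=
      (ih J []).comp_measurable ((Tape.measurable_evens.comp measurable_snd).prodMk
        (Tape.measurable_odds.comp measurable_snd))
    classical
    simp only [serve]
    -- Once the output so far is fixed, the decision to interrupt is deterministic; the fallback and
    -- the new configuration are fixed likewise below.
    refine (h₁ (w ++ [a])).bind (F := fun y p => if R.go I (w ++ [a]) y then
      A.answer p.1 I (w ++ [a]) :: A.serve R p.1 p.2 I (w ++ [a]) z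
      else R.fallback I w (A.output p.1 I w) a :: A.serve R p.2.evens p.2.odds
        (R.restart I (w ++ [a]) (A.output p.1 I w ++ [R.fallback I w (A.output p.1 I w) a])) [] z)
      fun y => ?_
    by_cases hy : R.go I (w ++ [a]) y
    · simp only [hy, if_true]
      exact h₂.map₂ (ih I (w ++ [a])) List.cons
    · simp only [hy, if_false]
      exact (h₁ w).bind (F := fun y p => R.fallback I w y a :: A.serve R p.2.evens p.2.odds
        (R.restart I (w ++ [a]) (y ++ [R.fallback I w y a])) [] z) fun y => (h₃ _).map _

/-- Either the run of `A` is never interrupted, or it is interrupted at some request `a`. -/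
theorem serve_eq (ψ : Tape) (I : Conf) (z w : List Req) (hw : R.go I w (A.output ψ I w)) :
    ((∀ θ, A.output ψ I w ++ A.serve R ψ θ I w z = A.output ψ I (w ++ z)) ∧
      R.go I (w ++ z) (A.output ψ I (w ++ z))) ∨
    ∃ u a z', z = u ++ a :: z' ∧ R.go I (w ++ u) (A.output ψ I (w ++ u)) ∧
      ¬ R.go I (w ++ u ++ [a]) (A.output ψ I (w ++ u ++ [a])) ∧
      ∀ θ, A.output ψ I w ++ A.serve R ψ θ I w z = A.output ψ I (w ++ u) ++
        R.fallback I (w ++ u) (A.output ψ I (w ++ u)) a ::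
          A.serve R θ.evens θ.odds (R.restart I (w ++ u ++ [a]) (A.output ψ I (w ++ u) ++
            [R.fallback I (w ++ u) (A.output ψ I (w ++ u)) a])) [] z' := by
  induction z generalizing w with
  | nil => left; simpa [serve] using hw
  | cons a z ih =>
    by_cases ha : R.go I (w ++ [a]) (A.output ψ I (w ++ [a]))
    · have h (θ : Tape) : A.output ψ I w ++ A.serve R ψ θ I w (a :: z) =
          A.output ψ I (w ++ [a]) ++ A.serve R ψ θ I (w ++ [a]) z := by
        rw [serve, if_pos ha, output_concat, List.append_assoc, List.singleton_append]
      rcases ih (w ++ [a]) ha with h' | ⟨u, b, z', rfl, h₁, h₂, h₃⟩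
      · left
        simpa [h] using h'
      · right
        refine ⟨a :: u, b, z', rfl, by simpa using h₁, by simpa using h₂, fun θ => ?_⟩
        rw [h, h₃]
        simp
    · right
      refine ⟨[], a, z, rfl, by simpa using hw, by simpa using ha, fun θ => ?_⟩
      rw [serve, if_neg ha]
      simp

/-- The algorithm that restarts `A` according to `R`. -/
noncomputable def withRestarts : RandomizedOnlineAlgorithm Conf Req Ans where
  -- The default value is reached only for `x = []`, where the answer is irrelevant.
  answer φ I x := (A.serve R φ.evens φ.odds I [] x).getLastD (A.answer φ I x)
  countable_range I x := (((A.discreteMap_serve R x I []).comp_measurable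
    (Tape.measurable_evens.prodMk Tape.measurable_odds)).map₂ (A.discreteMap_answer I x)
      fun l a => l.getLastD a).1
  measurableSet_fiber I x := (((A.discreteMap_serve R x I []).comp_measurable
    (Tape.measurable_evens.prodMk Tape.measurable_odds)).map₂ (A.discreteMap_answer I x)
      fun l a => l.getLastD a).2

theorem output_withRestarts (φ : Tape) (I : Conf) (x : List Req) :
    (A.withRestarts R).output φ I x = A.serve R φ.evens φ.odds I [] x := by
  induction x using List.reverseRecOn with
  | nil => rw [output_nil, serve_nil]
  | append_singleton x a ih =>
    obtain ⟨b, hb⟩ := A.serve_concat R x a φ.evens φ.odds I []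
    rw [output_concat, ih, hb]
    simp [withRestarts, hb]

end RandomizedOnlineAlgorithm

/-! ### Admissible restarts and the exponential moment of the total cost -/

theorem List.exists_longest_prefix {α : Type*} {p : List α → Prop} (h : p []) (z : List α) :
    ∃ w, w <+: z ∧ p w ∧ ∀ v, v <+: z → p v → v <+: w := by
  induction z using List.reverseRecOn with
  | nil => exact ⟨[], List.prefix_rfl, h, fun v hv _ => hv⟩
  | append_singleton z a ih =>
    by_cases hz : p (z ++ [a])
    · exact ⟨z ++ [a], List.prefix_rfl, hz, fun v hv _ => hv⟩
    · obtain ⟨w, hw, hpw, hmax⟩ := ih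
      refine ⟨w, hw.trans (List.prefix_append _ _), hpw, fun v hv hpv => ?_⟩
      rcases List.prefix_concat_iff.mp hv with rfl | hv
      · exact absurd hpv hz
      · exact hmax v hv hpv

namespace RandomizedOnlineAlgorithm

variable {Conf Req Ans : Type*}

/-- A run of the algorithm goes on as long as its optimal cost is below `C` and its cost is at most
`D`, the fallback answers are optimal up to `B + 1` for the single request, and the restarts take
place in an equivalent state. -/
structure RestartRule.Admissible (R : RestartRule Conf Req Ans) (P : OnlineProblem Conf Req Ans)
    (B : ℝ≥0) (C D : ℝ) : Prop where
  go_iff : ∀ I x y, R.go I x y ↔ P.minOpt x < ENNReal.ofReal C ∧ P.cost I x y ≤ ENNReal.ofReal D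
  valid_fallback : ∀ I x y a, P.Valid I x y → P.Valid I (x ++ [a]) (y ++ [R.fallback I x y a])
  cost_fallback_le : ∀ I x y a, P.Valid I x y →
    P.cost I (x ++ [a]) (y ++ [R.fallback I x y a]) ≤ P.cost I x y + (P.minOpt [a] + B + 1)
  valid_restart : ∀ I x y x' y', P.Valid I x y → P.Valid (R.restart I x y) x' y' →
    P.Valid I (x ++ x') (y ++ y')
  cost_restart : ∀ I x y x' y', P.Valid I x y → P.Valid (R.restart I x y) x' y' →
    P.cost I (x ++ x') (y ++ y') = P.cost I x y + P.cost (R.restart I x y) x' y'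

variable {P : OnlineProblem Conf Req Ans} {B : ℝ≥0}

theorem RestartRule.exists_admissible (hP : P.Symmetric)
    (hB : ∀ (h : P.History) (x : List Req), h.opt x ≠ ∞ ∧ h.opt x ≤ P.minOpt x + B)
    (A : RandomizedOnlineAlgorithm Conf Req Ans) (C D : ℝ) :
    ∃ R : RestartRule Conf Req Ans, R.Admissible P B C D := by
  have hf (I : Conf) (x : List Req) (y : List Ans) (a : Req) : ∃ b, P.Valid I x y →
      P.Valid I (x ++ [a]) (y ++ [b]) ∧
        P.cost I (x ++ [a]) (y ++ [b]) ≤ P.cost I x y + (P.minOpt [a] + B + 1) := by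
    by_cases hv : P.Valid I x y
    · let h : P.History := ⟨I, x, y, hv⟩
      obtain ⟨b', hb, hb'⟩ := OnlineProblem.History.exists_validNext_nextCost_le (hB h [a]).1
      obtain ⟨b, rfl⟩ := List.length_eq_one_iff.mp hb.length_eq.symm
      refine ⟨b, fun _ => ⟨hb, ?_⟩⟩
      rw [← OnlineProblem.History.cost_add_nextCost hP.1 hb]
      gcongr
      exact hb'.trans (by gcongr; exact (hB h [a]).2)
    · exact ⟨A.answer (fun _ => true) I x, fun h => absurd h hv⟩
  have hr (I : Conf) (x : List Req) (y : List Ans) : ∃ J, ∀ hv : P.Valid I x y,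
      OnlineProblem.History.Equivalent ⟨I, x, y, hv⟩ (hP.1.start J) := by
    by_cases hv : P.Valid I x y
    · obtain ⟨J, hJ⟩ := hP.exists_start_equivalent ⟨I, x, y, hv⟩
      exact ⟨J, fun _ => hJ⟩
    · exact ⟨I, fun h => absurd h hv⟩
  choose f hf using hf
  choose s hs using hr
  have hv' (I x y x' y') (hv : P.Valid I x y) (hx' : P.Valid (s I x y) x' y') :=
    (hs I x y hv x' y').1.mpr (hP.1.validNext_start.mpr hx')
  refine ⟨⟨fun I x y => P.minOpt x < ENNReal.ofReal C ∧ P.cost I x y ≤ ENNReal.ofReal D, f, s⟩,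
    fun _ _ _ => Iff.rfl, fun I x y a hv => (hf I x y a hv).1,
    fun I x y a hv => (hf I x y a hv).2, hv', fun I x y x' y' hv hx' => ?_⟩
  have h := hv' I x y x' y' hv hx'
  have h' := (hs I x y hv x' y').2 h
  rw [hP.1.nextCost_start] at h'
  exact (h' ▸ OnlineProblem.History.cost_add_nextCost hP.1 h).symm

variable {R : RestartRule Conf Req Ans} {C D : ℝ}

theorem RestartRule.Admissible.go_nil (hR : R.Admissible P B C D) (hP : P.Partitionable)
    (hC : 0 < C) (I : Conf) : R.go I [] [] := by
  rw [hR.go_iff, hP.minOpt_nil I, hP.cost_nil]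
  simpa using hC

theorem valid_output_of_go (hR : R.Admissible P B C D) (A : RandomizedOnlineAlgorithm Conf Req Ans)
    {ψ : Tape} {I : Conf} {x : List Req} (h : R.go I x (A.output ψ I x)) :
    P.Valid I x (A.output ψ I x) :=
  ⟨(A.length_output ψ I x).symm,
    ne_top_of_le_ne_top ENNReal.ofReal_ne_top ((hR.go_iff _ _ _).mp h).2⟩

/-- An uninterrupted run costs at most `D`, and the remainder is handled by induction. Finiteness
matters because the exponential moment uses `toReal`, which sends `∞` to `0`. -/
theorem valid_serve (hR : R.Admissible P B C D) (hP : P.Partitionable) (hC : 0 < C)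
    (A : RandomizedOnlineAlgorithm Conf Req Ans) (z : List Req) (ψ θ : Tape) (I : Conf) :
    P.Valid I z (A.serve R ψ θ I [] z) := by
  rcases A.serve_eq R ψ I z [] (hR.go_nil hP hC I) with ⟨h, hgo⟩ | ⟨u, a, z', hz, hgo, -, h⟩
  · have := h θ
    simp only [List.nil_append, output_nil] at this hgo
    rw [this]
    exact valid_output_of_go hR A hgo
  · have := h θ
    simp only [List.nil_append, output_nil] at this hgo
    rw [this, hz, List.append_cons u, List.append_cons (A.output ψ I u)]
    exact hR.valid_restart _ _ _ _ _ (hR.valid_fallback _ _ _ _ (valid_output_of_go hR A hgo))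
      (valid_serve hR hP hC A z' _ _ _)
termination_by z.length
decreasing_by simp [hz]; omega

/-- The exponential moment of the cost of `A` with restarts. -/
noncomputable def expMoment (A : RandomizedOnlineAlgorithm Conf Req Ans)
    (R : RestartRule Conf Req Ans) (P : OnlineProblem Conf Req Ans) (l : ℝ) (I : Conf)
    (z : List Req) : ℝ≥0∞ :=
  ∫⁻ p, ENNReal.ofReal (Real.exp (l * (P.cost I z (A.serve R p.1 p.2 I [] z)).toReal))
    ∂(tapeMeasure.prod tapeMeasure)

/-- Conditioned on the tape of the first run, the exponential moment is bounded by the loss of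
this run. -/
theorem lintegral_exp_cost_serve_le (hR : R.Admissible P B C D) (hP : P.Partitionable)
    (hfin : ∀ x, P.minOpt x ≠ ∞) (hC : 0 < C) (hD : 0 < D)
    (A : RandomizedOnlineAlgorithm Conf Req Ans) {l r ε : ℝ} (hl : 0 ≤ l) (hr : 1 ≤ r)
    (hε : 0 < ε) {z w : List Req} (hwz : w <+: z) (hwC : P.minOpt w < ENNReal.ofReal C)
    (hmax : ∀ v, v <+: z → P.minOpt v < ENNReal.ofReal C → v <+: w)
    (ih : ∀ z', z'.length < z.length → ∀ I, A.expMoment R P l I z' ≤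
      ENNReal.ofReal (Real.exp (l * ((1 + ε) * r * (P.minOpt z').toReal + ε * r * C))))
    (ψ : Tape) (I : Conf) :
    ∫⁻ θ, ENNReal.ofReal (Real.exp (l * (P.cost I z (A.serve R ψ θ I [] z)).toReal)) ∂tapeMeasure ≤
      ENNReal.ofReal (Real.exp (l * ((1 + ε) * r * (P.minOpt z).toReal + ε * r * C))) *
      ENNReal.ofReal (Real.exp (l * runLoss D (r * (P.minOpt w).toReal + ε * r * C - B - 1)
        (C + B + 1) (A.cost P I w ψ))) := by
  have hmono {v : List Req} (hv : v <+: w) : P.cost I v (A.output ψ I v) ≤ A.cost P I w ψ := by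
    obtain ⟨t, rfl⟩ := hv
    obtain ⟨y, hy, hl⟩ := A.output_append ψ I v t
    rw [RandomizedOnlineAlgorithm.cost, hy]
    exact hP.cost_le_append I (A.length_output ψ I v).symm hl
  have hsuper (u v : List Req) :
      (P.minOpt u).toReal + (P.minOpt v).toReal ≤ (P.minOpt (u ++ v)).toReal := by
    rw [← ENNReal.toReal_add (hfin u) (hfin v)]
    exact ENNReal.toReal_mono (hfin _) (hP.minOpt_add_le u v)
  have hpos (u : List Req) : 0 ≤ (P.minOpt u).toReal := ENNReal.toReal_nonneg
  have hr0 : 0 < ε * r := by positivity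
  rcases A.serve_eq R ψ I z [] (hR.go_nil hP hC I) with ⟨h, hgo⟩ | ⟨u, a, z', hz, hgo, hcut, h⟩
  · simp only [List.nil_append, output_nil] at h hgo
    have hgo' := (hR.go_iff _ _ _).mp hgo
    -- The last run: there is no further request, and the term `ε * r * C` of the bound pays for it.
    have hzw : w = z := hwz.eq_of_length_le (hmax z List.prefix_rfl hgo'.1).length_le
    subst hzw
    simp only [h, lintegral_const, measure_univ, mul_one]
    rw [← ENNReal.ofReal_mul (Real.exp_pos _).le, ← Real.exp_add, ← mul_add]
    refine ENNReal.ofReal_le_ofReal (Real.exp_le_exp.mpr (mul_le_mul_of_nonneg_left ?_ hl))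
    rw [runLoss, if_pos (show A.cost P I w ψ ≤ _ from hgo'.2), RandomizedOnlineAlgorithm.cost]
    nlinarith [mul_nonneg hr0.le (hpos w), B.coe_nonneg]
  · simp only [List.nil_append, output_nil] at h hgo hcut
    have hgo' := (hR.go_iff _ _ _).mp hgo
    have hv := valid_output_of_go hR A hgo
    have hv' := hR.valid_fallback _ _ _ a hv
    set g := R.fallback I u (A.output ψ I u) a
    set J := R.restart I (u ++ [a]) (A.output ψ I u ++ [g])
    set c := P.cost I (u ++ [a]) (A.output ψ I u ++ [g])
    have hcost (θ : Tape) : (P.cost I z (A.serve R ψ θ I [] z)).toReal =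
        c.toReal + (P.cost J z' (A.serve R θ.evens θ.odds J [] z')).toReal := by
      have hJ := valid_serve hR hP hC A z' θ.evens θ.odds J
      rw [← ENNReal.toReal_add hv'.2 hJ.2, ← hR.cost_restart _ _ _ _ _ hv' hJ, h, hz,
        List.append_cons u, List.append_cons (A.output ψ I u)]
    have hc : c.toReal ≤ (P.cost I u (A.output ψ I u)).toReal + ((P.minOpt [a]).toReal + B + 1) := by
      have := ENNReal.toReal_mono (ENNReal.add_ne_top.mpr ⟨hv.2, by simp [hfin]⟩)
        (hR.cost_fallback_le _ _ _ a hv)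
      rwa [ENNReal.toReal_add hv.2 (by simp [hfin]), ENNReal.toReal_add (by simp [hfin]) (by simp),
        ENNReal.toReal_add (hfin _) (by simp)] at this
    have hmeas : Measurable fun p : Tape × Tape => ENNReal.ofReal
        (Real.exp (l * (P.cost J z' (A.serve R p.1 p.2 J [] z')).toReal)) :=
      (A.discreteMap_serve R z' J []).measurable fun y =>
        ENNReal.ofReal (Real.exp (l * (P.cost J z' y).toReal))
    have hlen : z'.length < z.length := by simp [hz]; omega
    calc _ = ENNReal.ofReal (Real.exp (l * c.toReal)) * A.expMoment R P l J z' := by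
          -- With `ψ` fixed, the cost of the first run is a constant and the rest is served from
          -- fresh bits.
          simp only [hcost, mul_add, Real.exp_add, ENNReal.ofReal_mul (Real.exp_pos _).le]
          rw [lintegral_const_mul' _ _ ENNReal.ofReal_ne_top, lintegral_evens_odds hmeas, expMoment]
      _ ≤ ENNReal.ofReal (Real.exp (l * c.toReal)) * ENNReal.ofReal
          (Real.exp (l * ((1 + ε) * r * (P.minOpt z').toReal + ε * r * C))) := by
          gcongr
          exact ih z' hlen J
      _ ≤ _ := by
          rw [← ENNReal.ofReal_mul (Real.exp_pos _).le, ← ENNReal.ofReal_mul (Real.exp_pos _).le,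
            ← Real.exp_add, ← Real.exp_add, ← mul_add, ← mul_add]
          refine ENNReal.ofReal_le_ofReal (Real.exp_le_exp.mpr (mul_le_mul_of_nonneg_left ?_ hl))
          have h₁ := hsuper u [a]
          have h₂ := hsuper (u ++ [a]) z'
          rw [← List.append_cons, ← hz] at h₂
          by_cases hua : P.minOpt (u ++ [a]) < ENNReal.ofReal C
          -- Cut off by cost: `u ++ [a]` is a prefix of `w`, so `A` on all of `w` also exceeds `D`.
          -- The run with its fallback costs at most `D + C + B + 1`, and its optimal cost is not
          -- credited.
          · have hover : ENNReal.ofReal D < A.cost P I w ψ := by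
              rw [hR.go_iff, not_and, not_le] at hcut
              refine (hcut hua).trans_le (hmono (hmax _ ?_ hua))
              exact ⟨z', by simp [hz]⟩
            rw [runLoss, if_neg (not_le.mpr hover)]
            have h₃ := ENNReal.toReal_le_of_le_ofReal hC.le hua.le
            have h₄ := ENNReal.toReal_le_of_le_ofReal hD.le hgo'.2
            have h₅ : (1 + ε) * r * (P.minOpt z').toReal ≤ (1 + ε) * r * (P.minOpt z).toReal :=
              mul_le_mul_of_nonneg_left (by linarith [hpos (u ++ [a])]) (by positivity)
            linarith [hpos u]
          -- Ended by optimal cost: the run served exactly `w`.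
          · have huw : w = u := by
              refine List.IsPrefix.eq_of_length_le ?_
                (hmax u ⟨a :: z', hz.symm⟩ hgo'.1).length_le
              rcases List.prefix_or_prefix_of_prefix hwz
                (show u ++ [a] <+: z from ⟨z', by simp [hz]⟩) with h' | h'
              · rcases List.prefix_concat_iff.mp h' with rfl | h'
                · exact absurd hwC hua
                · exact h'
              · obtain ⟨t, rfl⟩ := h'
                exact absurd ((le_self_add.trans (hP.minOpt_add_le _ t)).trans_lt hwC) hua
            subst huw
            rw [runLoss, if_pos (show A.cost P I w ψ ≤ _ from hgo'.2),
              RandomizedOnlineAlgorithm.cost]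
            have h₃ : C ≤ (P.minOpt (w ++ [a])).toReal :=
              (ENNReal.ofReal_le_iff_le_toReal (hfin _)).mp (not_lt.mp hua)
            have h₄ := hpos [a]
            have h₅ : (1 + ε) * r * ((P.minOpt (w ++ [a])).toReal + (P.minOpt z').toReal) ≤
                (1 + ε) * r * (P.minOpt z).toReal := by gcongr
            -- The share `r` of `minOpt (w ++ [a])` pays for `r * minOpt w` and the fallback's
            -- `minOpt [a]`, using `1 ≤ r`; the share `ε * r` is at least `ε * r * C`.
            nlinarith [mul_le_mul_of_nonneg_left h₃ hr0.le,
              mul_le_mul_of_nonneg_left h₁ (zero_le_one.trans hr), mul_nonneg (sub_nonneg.mpr hr) h₄]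

end RandomizedOnlineAlgorithm

namespace RandomizedOnlineAlgorithm

variable {Conf Req Ans : Type*} {P : OnlineProblem Conf Req Ans} {B : ℝ≥0}
  {R : RestartRule Conf Req Ans} {C D : ℝ}

/-- The prefix `w` depends on the input only, not on the tape, so the expected cost bound for `A`
applies to it. Integrating the conditional bound over the first tape then costs a factor at most
`1`. -/
theorem expMoment_le (hR : R.Admissible P B C D) (hP : P.Partitionable)
    (hB : ∀ (h : P.History) (x : List Req), h.opt x ≠ ∞ ∧ h.opt x ≤ P.minOpt x + B)
    (hfin : ∀ x, P.minOpt x ≠ ∞) (A : RandomizedOnlineAlgorithm Conf Req Ans) {r ε : ℝ} {α : ℝ≥0}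
    (hr : 1 ≤ r) (hε : 0 < ε)
    (hA : ∀ I x, P.opt I x ≠ ∞ →
      ∫⁻ φ, A.cost P I x φ ∂tapeMeasure ≤ ENNReal.ofReal r * P.opt I x + α)
    (hC : r * B + α + B + 3 ≤ ε * r * C) (hC0 : 0 < C) (hD0 : 0 < D)
    (hD : (r + ε * r + 1) * C * (r * (C + B) + α) ≤ D) {M : ℝ} (hM : 1 ≤ M)
    (hMD : (r + ε * r + 1) * C + D ≤ M) (z : List Req) (I : Conf) :
    A.expMoment R P (M⁻¹ ^ 2) I z ≤
      ENNReal.ofReal (Real.exp (M⁻¹ ^ 2 * ((1 + ε) * r * (P.minOpt z).toReal + ε * r * C))) := by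
  obtain ⟨w, hwz, hwC, hmax⟩ := List.exists_longest_prefix
    (p := fun v => P.minOpt v < ENNReal.ofReal C) (by simpa [hP.minOpt_nil I] using hC0) z
  have hmeas : Measurable fun p : Tape × Tape => ENNReal.ofReal
      (Real.exp (M⁻¹ ^ 2 * (P.cost I z (A.serve R p.1 p.2 I [] z)).toReal)) :=
    (A.discreteMap_serve R z I []).measurable fun y =>
      ENNReal.ofReal (Real.exp (M⁻¹ ^ 2 * (P.cost I z y).toReal))
  have hr0 : 0 < r := by linarith
  have hB0 := B.coe_nonneg
  have hα0 := α.coe_nonneg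
  have hw0 : 0 ≤ (P.minOpt w).toReal := ENNReal.toReal_nonneg
  have hw : (P.minOpt w).toReal ≤ C := ENNReal.toReal_le_of_le_ofReal hC0.le hwC.le
  have hrw : r * (P.minOpt w).toReal ≤ r * C := by gcongr
  set E := r * ((P.minOpt w).toReal + B) + α with hE
  have hE0 : 0 ≤ E := by positivity
  have hrun : ∫⁻ ψ, ENNReal.ofReal (Real.exp (M⁻¹ ^ 2 * runLoss D
      (r * (P.minOpt w).toReal + ε * r * C - B - 1) (C + B + 1) (A.cost P I w ψ)))
        ∂tapeMeasure ≤ 1 := by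
    refine lintegral_exp_runLoss_le_one (A.measurable_cost P I w) (E := E) hD0 hE0 (by positivity)
      hM (by linarith) ?_ ?_ (by rw [hE]; linarith)
    · have hopt := hB (hP.start I) w
      rw [hP.opt_start] at hopt
      calc _ ≤ ENNReal.ofReal r * P.opt I w + α := hA I w hopt.1
        _ ≤ ENNReal.ofReal r * (P.minOpt w + B) + α := by gcongr; exact hopt.2
        _ = ENNReal.ofReal E := by
          rw [hE, ENNReal.ofReal_add (by positivity) hα0, ENNReal.ofReal_mul hr0.le,
            ENNReal.ofReal_add hw0 hB0, ENNReal.ofReal_toReal (hfin w), ENNReal.ofReal_coe_nnreal,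
            ENNReal.ofReal_coe_nnreal]
    -- Here `a + b` is at most `(r + ε * r + 1) * C` and `E` at most `r * (C + B) + α`, since
    -- `minOpt w ≤ C`.
    · refine le_trans ?_ hD
      refine mul_le_mul (by linarith) (by rw [hE]; gcongr) hE0 (by positivity)
  calc A.expMoment R P (M⁻¹ ^ 2) I z
      = ∫⁻ ψ, ∫⁻ θ, ENNReal.ofReal (Real.exp (M⁻¹ ^ 2 *
          (P.cost I z (A.serve R ψ θ I [] z)).toReal)) ∂tapeMeasure ∂tapeMeasure := by
        rw [expMoment, lintegral_prod _ hmeas.aemeasurable]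
    _ ≤ ∫⁻ ψ, ENNReal.ofReal (Real.exp (M⁻¹ ^ 2 *
          ((1 + ε) * r * (P.minOpt z).toReal + ε * r * C))) *
        ENNReal.ofReal (Real.exp (M⁻¹ ^ 2 * runLoss D
          (r * (P.minOpt w).toReal + ε * r * C - B - 1) (C + B + 1) (A.cost P I w ψ)))
            ∂tapeMeasure :=
        lintegral_mono fun ψ => lintegral_exp_cost_serve_le hR hP hfin hC0 hD0 A (by positivity)
          hr hε hwz hwC hmax (fun z' _ I' => expMoment_le hR hP hB hfin A hr hε hA hC hC0 hD0 hD
            hM hMD z' I') ψ I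
    _ ≤ _ := by
        rw [lintegral_const_mul' _ _ ENNReal.ofReal_ne_top]
        exact mul_le_of_le_one_right' hrun
termination_by z.length

end RandomizedOnlineAlgorithm

/-! ### Tail bound and choice of constants -/

theorem Real.exists_mul_log_le (b c : ℝ) (hb : 0 < b) (hc : 0 < c) :
    ∃ K : ℝ, ∀ t, 0 ≤ t → b * Real.log (2 + t) ≤ c * t + K := by
  refine ⟨2 * c - b * Real.log (c / b), fun t ht => ?_⟩
  have h₁ : Real.log ((2 + t) * (c / b)) ≤ (2 + t) * (c / b) :=
    (Real.log_le_sub_one_of_pos (by positivity)).trans (by linarith)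
  rw [Real.log_mul (by positivity) (by positivity)] at h₁
  have h₂ := mul_le_mul_of_nonneg_left h₁ hb.le
  have h₃ : b * ((2 + t) * (c / b)) = c * (2 + t) := by field_simp
  linarith

theorem theorem1 {Conf Req Ans : Type*} (P : OnlineProblem Conf Req Ans)
    (hopt : P.OptBounded) (hsymm : P.Symmetric)
    (r : ℝ) (hr : 1 ≤ r)
    (A : RandomizedOnlineAlgorithm Conf Req Ans) (hA : A.CompetitiveInExpectation P r)
    (ε : ℝ) (hε : 0 < ε) :
    ∃ A' : RandomizedOnlineAlgorithm Conf Req Ans, A'.CompetitiveWHP P ((1 + ε) * r) := by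
  obtain ⟨B, hB⟩ := hopt.exists_bound
  obtain ⟨α, hA⟩ := hA
  have hr0 : 0 < r := by linarith
  -- Half of `ε` is spent on the moment bound; the other half dominates `β * log (2 + o)`.
  set δ := ε / 2 with hδ
  have hδ0 : 0 < δ := by positivity
  -- `C` makes the slack `δ * r * C` just cover the additive terms; `D` then makes cutoffs rare
  -- enough, and `M` bounds the loss of a run. None of them depends on `β`.
  set C := (r * B + α + B + 3) / (δ * r) with hC
  have hC0 : 0 < C := by positivity
  set D := (r + δ * r + 1) * C * (r * (C + B) + α) + 1 with hD
  have hD0 : 0 < D := by positivity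
  set M := (r + δ * r + 1) * C + D + 1 with hM
  have hM0 : 1 ≤ M := by
    have : 0 < (r + δ * r + 1) * C := by positivity
    linarith
  obtain ⟨R, hR⟩ := RandomizedOnlineAlgorithm.RestartRule.exists_admissible hsymm hB A C D
  refine ⟨A.withRestarts R, fun β hβ => ?_⟩
  set l := M⁻¹ ^ 2 with hl
  have hl0 : 0 < l := by positivity
  obtain ⟨K, hK⟩ := Real.exists_mul_log_le β (l * (δ * r)) (by linarith) (by positivity)
  -- `δ * r * C` covers the additive term of the moment bound, and `K / l` the constant in the
  -- logarithmic estimate.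
  refine ⟨Real.toNNReal (δ * r * C + K / l), fun I x hx => ?_⟩
  have hα : δ * r * C + K / l ≤ (Real.toNNReal (δ * r * C + K / l) : ℝ) := Real.le_coe_toNNReal _
  set a := Real.toNNReal (δ * r * C + K / l)
  have hfin (z : List Req) : P.minOpt z ≠ ∞ :=
    ne_top_of_le_ne_top (hB (hsymm.1.start I) z).1 (P.minOpt_le _ z)
  have hmoment := RandomizedOnlineAlgorithm.expMoment_le hR hsymm.1 hB hfin A hr hδ0 hA
    (by rw [hC, mul_div_cancel₀ _ (by positivity)]) hC0 hD0 (by linarith) hM0 (by linarith) x I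
  have hmin : (P.minOpt x).toReal ≤ (P.opt I x).toReal := by
    refine ENNReal.toReal_mono hx ?_
    rw [← hsymm.1.opt_start]
    exact P.minOpt_le _ x
  have hmeas : Measurable fun p : Tape × Tape => ENNReal.ofReal
      (Real.exp (l * (P.cost I x (A.serve R p.1 p.2 I [] x)).toReal)) :=
    (A.discreteMap_serve R x I []).measurable fun y =>
      ENNReal.ofReal (Real.exp (l * (P.cost I x y).toReal))
  set o := (P.opt I x).toReal with ho
  have ho0 : 0 ≤ o := ENNReal.toReal_nonneg
  set T := (1 + ε) * r * o + a with hT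
  have hTE : ENNReal.ofReal ((1 + ε) * r) * P.opt I x + a = ENNReal.ofReal T := by
    rw [hT, ENNReal.ofReal_add (by positivity) a.coe_nonneg,
      ENNReal.ofReal_mul (p := (1 + ε) * r) (by positivity),
      ho, ENNReal.ofReal_toReal hx, ENNReal.ofReal_coe_nnreal]
  rw [hTE]
  have hsub : {φ | ENNReal.ofReal T ≤ (A.withRestarts R).cost P I x φ} ⊆
      {φ : Tape | ENNReal.ofReal (Real.exp (l * T)) ≤ ENNReal.ofReal
        (Real.exp (l * (P.cost I x (A.serve R φ.evens φ.odds I [] x)).toReal))} := by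
    intro φ (hφ : ENNReal.ofReal T ≤ P.cost I x ((A.withRestarts R).output φ I x))
    rw [RandomizedOnlineAlgorithm.output_withRestarts] at hφ
    refine ENNReal.ofReal_le_ofReal (Real.exp_le_exp.mpr (mul_le_mul_of_nonneg_left ?_ hl0.le))
    exact (ENNReal.ofReal_le_iff_le_toReal
      (RandomizedOnlineAlgorithm.valid_serve hR hsymm.1 hC0 A x _ _ I).2).mp hφ
  have hpos : ENNReal.ofReal (Real.exp (l * T)) ≠ 0 := by simp [Real.exp_pos]
  calc _ ≤ _ := measure_mono hsub
    _ ≤ A.expMoment R P l I x / ENNReal.ofReal (Real.exp (l * T)) := by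
        rw [RandomizedOnlineAlgorithm.expMoment, ← lintegral_evens_odds hmeas]
        exact meas_ge_le_lintegral_div
          (hmeas.comp (Tape.measurable_evens.prodMk Tape.measurable_odds)).aemeasurable hpos
          ENNReal.ofReal_ne_top
    _ ≤ ENNReal.ofReal (Real.exp (l * ((1 + δ) * r * (P.minOpt x).toReal + δ * r * C))) /
          ENNReal.ofReal (Real.exp (l * T)) := by gcongr
    _ = ENNReal.ofReal (Real.exp (l * ((1 + δ) * r * (P.minOpt x).toReal + δ * r * C) - l * T)) := by
        rw [← ENNReal.ofReal_div_of_pos (Real.exp_pos _), ← Real.exp_sub]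
    _ ≤ ENNReal.ofReal (Real.exp (Real.log (2 + o) * (-β))) := by
        refine ENNReal.ofReal_le_ofReal (Real.exp_le_exp.mpr ?_)
        have h₁ : l * (δ * r * C) + K ≤ l * a := by
          calc _ = l * (δ * r * C + K / l) := by field_simp
            _ ≤ _ := by gcongr
        have h₂ : l * ((1 + δ) * r * (P.minOpt x).toReal) ≤ l * ((1 + δ) * r * o) := by gcongr
        have h₃ : l * T = l * ((1 + δ) * r * o) + l * (δ * r) * o + l * a := by
          rw [hT, hδ]
          ring
        linarith [hK o ho0]
    _ = (2 + P.opt I x) ^ (-β) := by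
        rw [← Real.rpow_def_of_pos (by positivity), ← ENNReal.ofReal_rpow_of_pos (by positivity),
          ENNReal.ofReal_add zero_le_two ho0, ho, ENNReal.ofReal_toReal hx, ENNReal.ofReal_ofNat]
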